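/- Consider a two-hop amplify-and-forward (A&F) network with a source with $N_s\ge 1$ antennas, $R\ge 1$ single-antenna relays and a destination with $N_d\ge 1$ antennas. Let the coefficients $f_{n,r}$ (source antenna $n$ to relay $r$) and $g_{r,j}$ (relay $r$ to destination antenna $j$) be mutually independent, zero-mean, circularly symmetric complex Gaussian random variables (Rayleigh fading) with variances $\sigma_{f_r}^2>0$ and $\sigma_{g_r}^2>0$, and let $\boldsymbol f_r=(f_{1,r},\dots,f_{N_s,r})$, $\boldsymbol g_r=(g_{r,1},\dots,g_{r,N_d})$. The noise variances at the relays and at the destination are $\mathcal N_1,\mathcal N_2>0$. Of the total power $P$, the orthogonally space-time coded source uses $P_1=\tau P$ in the first phase, and $P_2=(1-\tau)P$ is used by the relays in the second phase; the fraction $\tau$ is constant in $(0,1)$ or, more generally, may depend on $P$ as long as it lies in some interval $[\varepsilon,1-\varepsilon]$, $\varepsilon>0$, for all large $P$. If the relays transmit with average powers $p_1,\dots,p_R$, relay $r$ amplifies by $\rho_r=\sqrt{p_r/(\sigma_{f_r}^2P_1+\mathcal N_1)}$ and the received instantaneous SNR is $$\mathrm{SNR}=\sum_{r=1}^R\frac{P_1\rho_r^2\|\boldsymbol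 f_r\|^2\|\boldsymbol g_r\|^2}{N_s\sum_{k=1}^R\rho_k^2\|\boldsymbol g_k\|^2\mathcal N_1+N_sN_d\mathcal N_2}.$$ Let $\gamma_r$ be this SNR when relay $r$ transmits with the whole power $P_2$ and all other relays are silent. In opportunistic relaying, for each channel realization only a relay with the largest $\gamma_r$ transmits, so that the received SNR is $\gamma_{\max}=\max_{1\le r\le R}\gamma_r$, and the average symbol error rate is $$P_e(R)=\mathbb E\big[c\,Q(\sqrt{\kappa\,\gamma_{\max}})\big],\qquad Q(x)=\frac1{\sqrt{2\pi}}\int_x^\infty e^{-u^2/2}\,du,$$ with constants $c,\kappa>0$ that depend only on the modulation ($c=2$, $\kappa=2\sin^2(\pi/M)$ for $M$-PSK; $c=4(\sqrt M-1)/\sqrt M$, $\kappa=3/(M-1)$ for $M$-QAM). Let $\mu=P/\mathcal N_0$ be the transmit SNR, where $\mathcal N_0>0$ is a fixed reference noise level (for example $\mathcal N_1$ or $\mathcal N_2$). Then the scheme has diversity order $R\min\{N_s,N_d\}$: $$-\lim_{\mu\to\infty}\frac{\log P_e(R)}{\log\mu}=R\min\{N_s,N_d\}.$$ -/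

import Mathlib

open MeasureTheory ProbabilityTheory Filter Topology
open scoped NNReal

noncomputable section

/-- The zero-mean circularly symmetric complex Gaussian law of variance `v`: the real and the
imaginary part are independent real Gaussians `N(0, v/2)`, so that `𝔼|Z|² = v` and `|Z|` is
Rayleigh distributed. -/
def complexGaussian (v : ℝ≥0) : Measure ℂ :=
  ((gaussianReal 0 (v / 2)).prod (gaussianReal 0 (v / 2))).map
    (fun p : ℝ × ℝ => (p.1 : ℂ) + (p.2 : ℂ) * Complex.I)

/-- Independent Rayleigh fading in a network with `R` single-antenna relays, `Ns` source antennas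
and `Nd` destination antennas: `f r n` is the channel from source antenna `n` to relay `r`,
`g r j` the channel from relay `r` to destination antenna `j`. -/
structure IsRayleighFading {Ω : Type*} [MeasurableSpace Ω] (prob : Measure Ω) {R Ns Nd : ℕ}
    (vf vg : Fin R → ℝ≥0) (f : Fin R → Fin Ns → Ω → ℂ) (g : Fin R → Fin Nd → Ω → ℂ) : Prop where
  law_f : ∀ r n, HasLaw (f r n) (complexGaussian (vf r)) prob
  law_g : ∀ r j, HasLaw (g r j) (complexGaussian (vg r)) prob
  indep : iIndepFun
    (Sum.elim (fun i : Fin R × Fin Ns => f i.1 i.2) (fun i : Fin R × Fin Nd => g i.1 i.2)) prob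

/-- The squared Euclidean norm `‖h‖²` of a vector of channel coefficients. -/
def channelGain {n : ℕ} (h : Fin n → ℂ) : ℝ := ∑ i, ‖h i‖ ^ 2

/-- The amplification factor `ρ_r` of an amplify-and-forward relay with average transmit power `p`,
when the source uses power `P₁`, the source-relay links have variance `v` and the relay noise has
variance `N₁`. -/
def relayScaling (P₁ N₁ v p : ℝ) : ℝ := Real.sqrt (p / (v * P₁ + N₁))

/-- The instantaneous received SNR of amplify-and-forward relaying of an orthogonal space-time
coded source, for source power `P₁`, relay powers `p r`, relay noise variance `N₁`, destination
noise variance `N₂` and channel realization `f`, `g`. -/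
def receivedSNR {R Ns Nd : ℕ} (N₁ N₂ P₁ : ℝ) (vf : Fin R → ℝ≥0) (p : Fin R → ℝ)
    (f : Fin R → Fin Ns → ℂ) (g : Fin R → Fin Nd → ℂ) : ℝ :=
  ∑ r, P₁ * relayScaling P₁ N₁ (vf r) (p r) ^ 2 * channelGain (f r) * channelGain (g r) /
    (Ns * ∑ k, relayScaling P₁ N₁ (vf k) (p k) ^ 2 * channelGain (g k) * N₁ + Ns * Nd * N₂)

/-- The received SNR `γ_r` when relay `r` transmits with the whole second-phase power `P₂` and all
other relays are silent. -/
def relaySNR {R Ns Nd : ℕ} (N₁ N₂ P₁ P₂ : ℝ) (vf : Fin R → ℝ≥0)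
    (f : Fin R → Fin Ns → ℂ) (g : Fin R → Fin Nd → ℂ) (r : Fin R) : ℝ :=
  receivedSNR N₁ N₂ P₁ vf (Pi.single r P₂) f g

/-- The received SNR `γ_max = max_r γ_r` of opportunistic relaying: for each channel realization
only a relay with the largest `γ_r` transmits. -/
def opportunisticSNR {R Ns Nd : ℕ} (N₁ N₂ P₁ P₂ : ℝ) (vf : Fin R → ℝ≥0)
    (f : Fin R → Fin Ns → ℂ) (g : Fin R → Fin Nd → ℂ) : ℝ :=
  ⨆ r, relaySNR N₁ N₂ P₁ P₂ vf f g r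

/-- The Gaussian tail function. -/
def gaussianQ (x : ℝ) : ℝ :=
  1 / Real.sqrt (2 * Real.pi) * ∫ u in Set.Ioi x, Real.exp (-u ^ 2 / 2)

/-- The average symbol error rate of amplify-and-forward opportunistic relaying: the conditional
SER `c Q(√(κ γ_max))`, averaged over the fading. The modulation enters through `c` and `κ`:
`c = 2`, `κ = 2 sin²(π/M)` for `M`-PSK, and `c = 4 (√M - 1)/√M`, `κ = 3/(M - 1)` for `M`-QAM. -/
def opportunisticSER {Ω : Type*} [MeasurableSpace Ω] (prob : Measure Ω) {R Ns Nd : ℕ}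
    (c κ N₁ N₂ P₁ P₂ : ℝ) (vf : Fin R → ℝ≥0)
    (f : Fin R → Fin Ns → Ω → ℂ) (g : Fin R → Fin Nd → Ω → ℂ) : ℝ :=
  ∫ ω, c * gaussianQ (Real.sqrt (κ * opportunisticSNR N₁ N₂ P₁ P₂ vf
    (fun r n => f r n ω) (fun r j => g r j ω))) ∂prob

/-- The scheme whose symbol error rate at transmit SNR `μ` is `Pe μ` has diversity order `d`. -/
def HasDiversityOrder (Pe : ℝ → ℝ) (d : ℝ) : Prop :=
  Tendsto (fun μ : ℝ => -(Real.log (Pe μ) / Real.log μ)) atTop (𝓝 d)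

end

/-!
Write `F_r = ‖f_r‖²` and `G_r = ‖g_r‖²`. At high transmit SNR `μ` the squared amplification factors
stay between positive constants, so `γ_r` lies between constant multiples of `μ F_r min(G_r, 1)` and
of `μ F_r G_r` (`exists_relaySNR_bounds`). It remains to bound the error rate by powers of `μ`
(`hasDiversityOrder_of_bounds`).

*The diversity order is at most `R min(Ns, Nd)`.* If, at all relays, every coefficient of the hop
with fewer antennas has power `O(1/μ)` and every coefficient of the other hop has power at most `1`,
then `κ γ_max ≤ 1` and the conditional error rate is at least `c Q(1)`. A complex Gaussian has power
at most `t` with probability at least of order `t`, so by independence this event has probability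
at least of order `μ ^ (-R min(Ns, Nd))` (`IsRayleighFading.exists_le_opportunisticSER`).

*It is at least `R min(Ns, Nd)`.* Let `s < min(Ns, Nd)`. Since `Q` decays faster than any power, the
conditional error rate is `O(γ_max ^ (-R s))`, and `γ_max ^ (-R s) ≤ ∏ r, γ_r ^ (-s)`. A sum of
squares dominates the geometric mean of its terms, so `γ_r ^ (-s)` is at most
`(a μ) ^ (-s) ∏ n, w(f_{n,r}) ^ (-s/Ns) ∏ j, w(g_{r,j}) ^ (-s/Nd)` with `w(z) = min(|z|, 1)²`. The
exponents `s/Ns` and `s/Nd` are less than `1`, and for `q < 1` the moment `𝔼 w(Z) ^ (-q)` of a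
complex Gaussian `Z` is finite. By independence the error rate is `O(μ ^ (-R s))`
(`IsRayleighFading.exists_opportunisticSER_le`). No distribution of the norms, and no separate
treatment of the logarithmic factor that occurs for `Ns = Nd`, is needed.
-/

/-! ### Products of independent random variables -/

lemma lintegral_prod_comp_of_iIndepFun {Ω ι 𝓧 : Type*} [MeasurableSpace Ω] [MeasurableSpace 𝓧]
    [Fintype ι] {μ : Measure Ω} {X : ι → Ω → 𝓧} (hX : iIndepFun X μ)
    (hXm : ∀ i, AEMeasurable (X i) μ) {φ : ι → 𝓧 → ENNReal} (hφ : ∀ i, Measurable (φ i)) :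
    ∫⁻ ω, ∏ i, φ i (X i ω) ∂μ = ∏ i, ∫⁻ ω, φ i (X i ω) ∂μ := by
  have hY : iIndepFun (fun i => (hXm i).mk (X i)) μ := hX.congr fun i => (hXm i).ae_eq_mk
  have hZ := hY.comp φ hφ
  have key := lintegral_prod_eq_prod_lintegral_of_indepFun (μ := μ) Finset.univ
    (fun i => φ i ∘ (hXm i).mk (X i)) hZ fun i => (hφ i).comp (hXm i).measurable_mk
  have hall : ∀ᵐ ω ∂μ, ∀ i, X i ω = (hXm i).mk (X i) ω :=
    ae_all_iff.2 fun i => (hXm i).ae_eq_mk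
  calc ∫⁻ ω, ∏ i, φ i (X i ω) ∂μ
      = ∫⁻ ω, ∏ i, (φ i ∘ (hXm i).mk (X i)) ω ∂μ := by
        refine lintegral_congr_ae ?_
        filter_upwards [hall] with ω hω
        simp only [Function.comp, ← hω]
    _ = ∏ i, ∫⁻ ω, (φ i ∘ (hXm i).mk (X i)) ω ∂μ := by
        rw [← key]
    _ = ∏ i, ∫⁻ ω, φ i (X i ω) ∂μ := by
        refine Finset.prod_congr rfl fun i _ => lintegral_congr_ae ?_
        filter_upwards [hall] with ω hω
        simp only [Function.comp, ← hω]

/-! ### Small-ball estimates for Gaussian laws -/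

lemma gaussianPDFReal_zero_anti (v : ℝ≥0) {x y : ℝ} (h : |x| ≤ |y|) :
    gaussianPDFReal 0 v y ≤ gaussianPDFReal 0 v x := by
  simp only [gaussianPDFReal_def, sub_zero]
  refine mul_le_mul_of_nonneg_left (Real.exp_le_exp.2 ?_) (by positivity)
  exact div_le_div_of_nonneg_right (neg_le_neg (sq_le_sq.2 h)) (by positivity)

/-- A centred Gaussian density is bounded below near the origin, so intervals `[-δ, δ]` with
`δ ≤ 1` have probability at least of order `δ`. -/
lemma exists_le_gaussianReal_Icc {v : ℝ≥0} (hv : v ≠ 0) :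
    ∃ c : ℝ, 0 < c ∧ ∀ δ : ℝ, 0 ≤ δ → δ ≤ 1 →
      ENNReal.ofReal (c * δ) ≤ gaussianReal 0 v (Set.Icc (-δ) δ) := by
  refine ⟨2 * gaussianPDFReal 0 v 1, by have := gaussianPDFReal_pos 0 v 1 hv; positivity,
    fun δ h0 h1 => ?_⟩
  have hp := gaussianPDFReal_nonneg 0 v 1
  rw [gaussianReal_apply 0 hv]
  calc ENNReal.ofReal (2 * gaussianPDFReal 0 v 1 * δ)
      = ∫⁻ _ in Set.Icc (-δ) δ, gaussianPDF 0 v 1 := by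
        rw [setLIntegral_const, Real.volume_Icc, gaussianPDF, ← ENNReal.ofReal_mul hp]
        congr 1; ring
    _ ≤ ∫⁻ x in Set.Icc (-δ) δ, gaussianPDF 0 v x := by
        refine setLIntegral_mono (measurable_gaussianPDF 0 v) fun x hx => ?_
        refine ENNReal.ofReal_le_ofReal (gaussianPDFReal_zero_anti v ?_)
        rw [abs_one]
        exact (abs_le.2 hx).trans h1

lemma measurable_ofReal_add_mul_I :
    Measurable (fun p : ℝ × ℝ => (p.1 : ℂ) + (p.2 : ℂ) * Complex.I) := by fun_prop

/-- The squared modulus of a complex Gaussian variable is at most `t` with probability at least of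
order `t`. -/
lemma exists_le_complexGaussian_sq_norm_le {v : ℝ≥0} (hv : 0 < v) :
    ∃ c : ℝ, 0 < c ∧ ∀ t : ℝ, 0 ≤ t → t ≤ 1 →
      ENNReal.ofReal (c * t) ≤ complexGaussian v {z | ‖z‖ ^ 2 ≤ t} := by
  obtain ⟨c, hc, h⟩ := exists_le_gaussianReal_Icc (v := v / 2) (by positivity)
  refine ⟨c ^ 2 / 2, by positivity, fun t h0 h1 => ?_⟩
  have hs0 : 0 ≤ √(t / 2) := Real.sqrt_nonneg _
  have hs2 : √(t / 2) ^ 2 = t / 2 := Real.sq_sqrt (by positivity)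
  have hs1 : √(t / 2) ≤ 1 := Real.sqrt_le_one.2 (by linarith)
  have hδ := h _ hs0 hs1
  have hmeas : MeasurableSet {z : ℂ | ‖z‖ ^ 2 ≤ t} :=
    measurableSet_le (by fun_prop) measurable_const
  rw [complexGaussian, Measure.map_apply measurable_ofReal_add_mul_I hmeas]
  calc ENNReal.ofReal (c ^ 2 / 2 * t)
      = ENNReal.ofReal (c * √(t / 2)) * ENNReal.ofReal (c * √(t / 2)) := by
        rw [← ENNReal.ofReal_mul (by positivity)]
        congr 1
        linear_combination (-c ^ 2) * hs2
    _ ≤ gaussianReal 0 (v / 2) (Set.Icc (-√(t / 2)) (√(t / 2))) *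
          gaussianReal 0 (v / 2) (Set.Icc (-√(t / 2)) (√(t / 2))) := by gcongr
    _ = ((gaussianReal 0 (v / 2)).prod (gaussianReal 0 (v / 2)))
          (Set.Icc (-√(t / 2)) (√(t / 2)) ×ˢ Set.Icc (-√(t / 2)) (√(t / 2))) := by
        rw [Measure.prod_prod]
    _ ≤ _ := by
        refine measure_mono ?_
        rintro ⟨x, y⟩ ⟨hx, hy⟩
        have hx2 : x ^ 2 ≤ √(t / 2) ^ 2 := sq_le_sq' hx.1 hx.2
        have hy2 : y ^ 2 ≤ √(t / 2) ^ 2 := sq_le_sq' hy.1 hy.2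
        simp only [Set.mem_preimage, Set.mem_ofPred_eq]
        rw [Complex.sq_norm, Complex.normSq_add_mul_I]
        linarith

/-! ### Negative moments of Gaussian laws -/

lemma lintegral_Ioc_rpow_neg_lt_top {q : ℝ} (hq1 : q < 1) :
    ∫⁻ x in Set.Ioc (0 : ℝ) 1, ENNReal.ofReal |x| ^ (-q) < ⊤ := by
  have hint : IntegrableOn (fun x : ℝ => x ^ (-q)) (Set.Ioc 0 1) :=
    (intervalIntegral.intervalIntegrable_rpow' (a := 0) (b := 1) (r := -q) (by linarith)).1
  have h := hint.lintegral_lt_top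
  refine lt_of_le_of_lt (le_of_eq ?_) h
  refine setLIntegral_congr_fun measurableSet_Ioc fun x hx => ?_
  rw [abs_of_pos hx.1, ENNReal.ofReal_rpow_of_pos hx.1]

lemma lintegral_Icc_rpow_neg_lt_top {q : ℝ} (hq1 : q < 1) :
    ∫⁻ x in Set.Icc (-1 : ℝ) 1, ENNReal.ofReal |x| ^ (-q) < ⊤ := by
  have hpos := lintegral_Ioc_rpow_neg_lt_top hq1
  have hneg : ∫⁻ x in Set.Ico (-1 : ℝ) 0, ENNReal.ofReal |x| ^ (-q) < ⊤ := by
    have hmp := (Measure.measurePreserving_neg (volume : Measure ℝ)).setLIntegral_comp_preimage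
      (s := Set.Ioc (0 : ℝ) 1) measurableSet_Ioc
      (f := fun x : ℝ => ENNReal.ofReal |x| ^ (-q)) (by fun_prop)
    simp only [abs_neg] at hmp
    have hset : (Neg.neg ⁻¹' Set.Ioc (0 : ℝ) 1 : Set ℝ) = Set.Ico (-1) 0 := by
      ext x; constructor <;> rintro ⟨h1, h2⟩ <;> constructor <;> linarith
    rw [hset] at hmp
    rwa [hmp]
  have hsub : Set.Icc (-1 : ℝ) 1 ⊆ (Set.Ico (-1) 0 ∪ Set.Ioc 0 1) ∪ {0} := by
    intro x hx
    rcases lt_trichotomy x 0 with h | h | h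
    · exact Or.inl (Or.inl ⟨hx.1, h⟩)
    · exact Or.inr h
    · exact Or.inl (Or.inr ⟨h, hx.2⟩)
  calc _ ≤ ∫⁻ x in (Set.Ico (-1 : ℝ) 0 ∪ Set.Ioc 0 1) ∪ {0}, ENNReal.ofReal |x| ^ (-q) :=
        lintegral_mono_set hsub
    _ ≤ _ := lintegral_union_le _ _ _
    _ ≤ (_ + _) + 0 := by
        gcongr
        · exact lintegral_union_le _ _ _
        · simp
    _ < ⊤ := by simpa using ⟨hneg, hpos⟩

/-- The one-dimensional Gaussian density is bounded and `|x| ^ (-q)` is integrable near the origin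
for `q < 1`. The truncation at `1` makes the tails harmless. -/
lemma lintegral_gaussianReal_min_rpow_neg_lt_top {v : ℝ≥0} (hv : v ≠ 0) {q : ℝ}
    (hq1 : q < 1) :
    ∫⁻ x, ENNReal.ofReal (min |x| 1) ^ (-q) ∂(gaussianReal 0 v) < ⊤ := by
  have hle : ∀ x : ℝ, ENNReal.ofReal (min |x| 1) ^ (-q) ≤
      (Set.Icc (-1 : ℝ) 1).indicator (fun x => ENNReal.ofReal |x| ^ (-q)) x + 1 := by
    intro x
    by_cases hx : |x| ≤ 1
    · rw [Set.indicator_of_mem (Set.mem_Icc.2 (abs_le.1 hx)), min_eq_left hx]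
      exact le_self_add
    · rw [min_eq_right (not_le.1 hx).le]
      simp
  have hbd : ∫⁻ x in Set.Icc (-1 : ℝ) 1, ENNReal.ofReal |x| ^ (-q) ∂(gaussianReal 0 v) < ⊤ := by
    rw [gaussianReal_of_var_ne_zero 0 hv, restrict_withDensity measurableSet_Icc,
      lintegral_withDensity_eq_lintegral_mul _ (measurable_gaussianPDF 0 v) (by fun_prop)]
    calc _ ≤ ∫⁻ x in Set.Icc (-1 : ℝ) 1, gaussianPDF 0 v 0 * ENNReal.ofReal |x| ^ (-q) := by
          refine lintegral_mono fun x => ?_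
          simp only [Pi.mul_apply]
          gcongr
          exact ENNReal.ofReal_le_ofReal (gaussianPDFReal_zero_anti v (by simp))
      _ = gaussianPDF 0 v 0 * ∫⁻ x in Set.Icc (-1 : ℝ) 1, ENNReal.ofReal |x| ^ (-q) :=
          lintegral_const_mul _ (by fun_prop)
      _ < ⊤ := ENNReal.mul_lt_top gaussianPDF_lt_top (lintegral_Icc_rpow_neg_lt_top hq1)
  calc _ ≤ ∫⁻ x, (Set.Icc (-1 : ℝ) 1).indicator (fun x => ENNReal.ofReal |x| ^ (-q)) x + 1
          ∂(gaussianReal 0 v) := lintegral_mono hle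
    _ = ∫⁻ x in Set.Icc (-1 : ℝ) 1, ENNReal.ofReal |x| ^ (-q) ∂(gaussianReal 0 v) + 1 := by
        rw [lintegral_add_right _ measurable_const, lintegral_indicator measurableSet_Icc]
        simp
    _ < ⊤ := by simpa using hbd

lemma min_abs_mul_min_abs_le (x y : ℝ) :
    min |x| 1 * min |y| 1 ≤ min ‖(x : ℂ) + (y : ℂ) * Complex.I‖ 1 ^ 2 := by
  have h2 : ‖(x : ℂ) + (y : ℂ) * Complex.I‖ ^ 2 = x ^ 2 + y ^ 2 := by
    rw [Complex.sq_norm, Complex.normSq_add_mul_I]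
  have hx := abs_nonneg x
  have hy := abs_nonneg y
  rcases le_total ‖(x : ℂ) + (y : ℂ) * Complex.I‖ 1 with h | h
  · rw [min_eq_left h, h2]
    calc min |x| 1 * min |y| 1 ≤ |x| * |y| :=
          mul_le_mul (min_le_left _ _) (min_le_left _ _) (by positivity) hx
      _ ≤ x ^ 2 + y ^ 2 := by
          nlinarith [sq_abs x, sq_abs y, sq_nonneg (|x| - |y|), sq_nonneg x, sq_nonneg y]
  · rw [min_eq_right h, one_pow]
    exact mul_le_one₀ (min_le_right _ _) (by positivity) (min_le_right _ _)

/-- A complex Gaussian variable has negative absolute moments of every order below `2`. They follow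
from the one-dimensional moments because `|x| |y| ≤ |x + y i|²`. -/
lemma lintegral_complexGaussian_min_rpow_neg_lt_top {v : ℝ≥0} (hv : 0 < v) {q : ℝ} (hq0 : 0 ≤ q)
    (hq1 : q < 1) :
    ∫⁻ z, (ENNReal.ofReal (min ‖z‖ 1) ^ (2 : ℝ)) ^ (-q) ∂(complexGaussian v) < ⊤ := by
  rw [complexGaussian, lintegral_map (by fun_prop) measurable_ofReal_add_mul_I]
  calc _ ≤ ∫⁻ p : ℝ × ℝ, ENNReal.ofReal (min |p.1| 1) ^ (-q) * ENNReal.ofReal (min |p.2| 1) ^ (-q)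
          ∂((gaussianReal 0 (v / 2)).prod (gaussianReal 0 (v / 2))) := by
        refine lintegral_mono fun p => ?_
        simp only
        rw [← ENNReal.mul_rpow_of_ne_top ENNReal.ofReal_ne_top ENNReal.ofReal_ne_top,
          ENNReal.rpow_neg, ENNReal.rpow_neg]
        refine ENNReal.inv_le_inv.2 (ENNReal.rpow_le_rpow ?_ hq0)
        rw [← ENNReal.ofReal_mul (by positivity), ENNReal.rpow_two,
          ← ENNReal.ofReal_pow (by positivity)]
        exact ENNReal.ofReal_le_ofReal (min_abs_mul_min_abs_le _ _)
    _ = (∫⁻ x, ENNReal.ofReal (min |x| 1) ^ (-q) ∂(gaussianReal 0 (v / 2))) *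
          ∫⁻ x, ENNReal.ofReal (min |x| 1) ^ (-q) ∂(gaussianReal 0 (v / 2)) :=
        lintegral_prod_mul (f := fun x : ℝ => ENNReal.ofReal (min |x| 1) ^ (-q))
          (g := fun x : ℝ => ENNReal.ofReal (min |x| 1) ^ (-q)) (by fun_prop) (by fun_prop)
    _ < ⊤ := by
        have := lintegral_gaussianReal_min_rpow_neg_lt_top (v := v / 2) (by positivity) hq1
        exact ENNReal.mul_lt_top this this

/-! ### The Gaussian tail function -/

lemma integrable_exp_neg_sq_div {b : ℝ} (hb : 0 < b) :
    Integrable (fun u : ℝ => Real.exp (-u ^ 2 / b)) := by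
  convert! integrable_exp_neg_mul_sq (inv_pos.2 hb) using 3
  field_simp

lemma gaussianQ_antitone : Antitone gaussianQ := by
  intro x y hxy
  unfold gaussianQ
  refine mul_le_mul_of_nonneg_left ?_ (by positivity)
  exact setIntegral_mono_set (integrable_exp_neg_sq_div two_pos).integrableOn
    (ae_of_all _ fun u => (Real.exp_pos _).le) (Set.Ioi_subset_Ioi hxy).eventuallyLE

lemma gaussianQ_pos (x : ℝ) : 0 < gaussianQ x := by
  unfold gaussianQ
  refine mul_pos (by positivity) ?_
  rw [setIntegral_pos_iff_support_of_nonneg_ae (ae_of_all _ fun u => (Real.exp_pos _).le)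
    (integrable_exp_neg_sq_div two_pos).integrableOn]
  have : (Function.support fun u : ℝ => Real.exp (-u ^ 2 / 2)) = Set.univ := by
    ext u; simp [(Real.exp_pos _).ne']
  simp [this]

/-- A Chernoff-type bound; half of the exponent is spent on the integral, so that no change of
variables is needed. -/
lemma exists_gaussianQ_le :
    ∃ C : ℝ, 0 < C ∧ ∀ x : ℝ, 0 ≤ x → gaussianQ x ≤ C * Real.exp (-(x ^ 2 / 4)) := by
  have h4 := integrable_exp_neg_sq_div (b := 4) (by norm_num)
  refine ⟨1 / √(2 * Real.pi) * (1 + ∫ u : ℝ, Real.exp (-u ^ 2 / 4)), ?_, fun x hx => ?_⟩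
  · have : 0 ≤ ∫ u : ℝ, Real.exp (-u ^ 2 / 4) := integral_nonneg fun u => (Real.exp_pos _).le
    positivity
  rw [gaussianQ, mul_assoc]
  refine mul_le_mul_of_nonneg_left ?_ (by positivity)
  calc ∫ u in Set.Ioi x, Real.exp (-u ^ 2 / 2)
      ≤ ∫ u in Set.Ioi x, Real.exp (-u ^ 2 / 4) * Real.exp (-(x ^ 2 / 4)) := by
        refine setIntegral_mono_on (integrable_exp_neg_sq_div two_pos).integrableOn
          (h4.mul_const _).integrableOn measurableSet_Ioi fun u hu => ?_
        rw [← Real.exp_add, Real.exp_le_exp]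
        have : x ^ 2 ≤ u ^ 2 := pow_le_pow_left₀ hx (le_of_lt hu) 2
        linarith
    _ = (∫ u in Set.Ioi x, Real.exp (-u ^ 2 / 4)) * Real.exp (-(x ^ 2 / 4)) :=
        integral_mul_const _ _
    _ ≤ (1 + ∫ u : ℝ, Real.exp (-u ^ 2 / 4)) * Real.exp (-(x ^ 2 / 4)) := by
        gcongr
        have := setIntegral_le_integral (s := Set.Ioi x) h4
          (ae_of_all _ fun u => (Real.exp_pos _).le)
        linarith

/-- The exponential decays faster than any power. At `y = 0` the right-hand side is `⊤`. -/
lemma ofReal_exp_neg_le_rpow {y p : ℝ} (hy : 0 ≤ y) (hp : 0 < p) :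
    ENNReal.ofReal (Real.exp (-y)) ≤ ENNReal.ofReal (p ^ p) * ENNReal.ofReal y ^ (-p) := by
  rcases hy.eq_or_lt with rfl | hy
  · have : 0 < p ^ p := Real.rpow_pos_of_pos hp p
    rw [ENNReal.ofReal_zero, ENNReal.zero_rpow_of_neg (by linarith), ENNReal.mul_top]
    · exact le_top
    · simpa using this
  · rw [ENNReal.ofReal_rpow_of_pos hy, ← ENNReal.ofReal_mul (by positivity)]
    refine ENNReal.ofReal_le_ofReal ?_
    have h1 : y / p ≤ Real.exp (y / p) := by linarith [Real.add_one_le_exp (y / p)]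
    have h2 : (y / p) ^ p ≤ Real.exp y := by
      calc (y / p) ^ p ≤ Real.exp (y / p) ^ p := Real.rpow_le_rpow (by positivity) h1 hp.le
        _ = Real.exp y := by rw [← Real.exp_mul, div_mul_cancel₀ _ hp.ne']
    rw [Real.div_rpow hy.le hp.le, div_le_iff₀ (by positivity)] at h2
    rw [Real.exp_neg, Real.rpow_neg hy.le, ← div_eq_mul_inv, le_div_iff₀ (by positivity),
      inv_mul_le_iff₀ (Real.exp_pos y)]
    exact h2

/-! ### Channel gains -/

lemma channelGain_nonneg {n : ℕ} (h : Fin n → ℂ) : 0 ≤ channelGain h :=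
  Finset.sum_nonneg fun _ _ => by positivity

lemma sq_norm_le_channelGain {n : ℕ} (h : Fin n → ℂ) (i : Fin n) : ‖h i‖ ^ 2 ≤ channelGain h :=
  Finset.single_le_sum (f := fun i => ‖h i‖ ^ 2) (fun _ _ => by positivity) (Finset.mem_univ i)

lemma channelGain_le {n : ℕ} (h : Fin n → ℂ) {t : ℝ} (ht : ∀ i, ‖h i‖ ^ 2 ≤ t) :
    channelGain h ≤ n * t := by
  simpa [channelGain] using Finset.sum_le_card_nsmul Finset.univ (fun i => ‖h i‖ ^ 2) t
    fun i _ => ht i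

/-- The power `min(|z|, 1)²` of a single channel coefficient, truncated at `1`. It is
`ENNReal`-valued so that its negative powers are `⊤` at a vanishing coefficient. -/
noncomputable def truncPower (z : ℂ) : ENNReal := ENNReal.ofReal (min ‖z‖ 1) ^ (2 : ℝ)

@[fun_prop]
lemma measurable_truncPower : Measurable truncPower := by unfold truncPower; fun_prop

lemma truncPower_ne_top (z : ℂ) : truncPower z ≠ ⊤ :=
  ENNReal.rpow_ne_top_of_nonneg (by norm_num) ENNReal.ofReal_ne_top

lemma truncPower_eq (z : ℂ) : truncPower z = ENNReal.ofReal (min (‖z‖ ^ 2) 1) := by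
  rw [truncPower, ENNReal.rpow_two, ← ENNReal.ofReal_pow (by positivity)]
  congr 1
  rcases le_total ‖z‖ 1 with h | h
  · rw [min_eq_left h, min_eq_left (pow_le_one₀ (norm_nonneg z) h)]
  · rw [min_eq_right h, min_eq_right (one_le_pow₀ h), one_pow]

/-- A sum of squares dominates the geometric mean of its terms. -/
lemma prod_truncPower_rpow_le {n : ℕ} (hn : 0 < n) (h : Fin n → ℂ) :
    ∏ i, truncPower (h i) ^ (1 / n : ℝ) ≤ ENNReal.ofReal (min (channelGain h) 1) := by
  calc ∏ i, truncPower (h i) ^ (1 / n : ℝ)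
      ≤ ∏ _i : Fin n, ENNReal.ofReal (min (channelGain h) 1) ^ (1 / n : ℝ) := by
        refine Finset.prod_le_prod' fun i _ => ENNReal.rpow_le_rpow ?_ (by positivity)
        rw [truncPower_eq]
        exact ENNReal.ofReal_le_ofReal (min_le_min_right _ (sq_norm_le_channelGain h i))
    _ = ENNReal.ofReal (min (channelGain h) 1) := by
        rw [Finset.prod_const, Finset.card_univ, Fintype.card_fin, ← ENNReal.rpow_natCast,
          ← ENNReal.rpow_mul, one_div_mul_cancel (by positivity), ENNReal.rpow_one]

/-! ### The received SNR -/

section SNR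

variable {R Ns Nd : ℕ} {N₁ N₂ P₁ P₂ : ℝ} {vf : Fin R → ℝ≥0}

/-- With a single active relay, the sums over the relays collapse. -/
lemma relaySNR_eq (f : Fin R → Fin Ns → ℂ) (g : Fin R → Fin Nd → ℂ) (r : Fin R)
    (h : 0 ≤ P₂ / (vf r * P₁ + N₁)) :
    relaySNR N₁ N₂ P₁ P₂ vf f g r =
      P₁ * (P₂ / (vf r * P₁ + N₁)) * channelGain (f r) * channelGain (g r) /
        (Ns * (P₂ / (vf r * P₁ + N₁) * channelGain (g r) * N₁) + Ns * Nd * N₂) := by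
  have hz : ∀ k ≠ r, relayScaling P₁ N₁ (vf k) (Pi.single (M := fun _ => ℝ) r P₂ k) = 0 := by
    intro k hk
    simp [relayScaling, Pi.single_eq_of_ne hk]
  have hr : relayScaling P₁ N₁ (vf r) (Pi.single (M := fun _ => ℝ) r P₂ r) ^ 2 =
      P₂ / (vf r * P₁ + N₁) := by
    rw [relayScaling, Pi.single_eq_same, Real.sq_sqrt h]
  have hden : ∑ k, relayScaling P₁ N₁ (vf k) (Pi.single (M := fun _ => ℝ) r P₂ k) ^ 2 *
      channelGain (g k) * N₁ = P₂ / (vf r * P₁ + N₁) * channelGain (g r) * N₁ := by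
    rw [Finset.sum_eq_single r (fun k _ hk => by rw [hz k hk]; simp) (by simp), hr]
  rw [relaySNR, receivedSNR, hden,
    Finset.sum_eq_single r (fun k _ hk => by rw [hz k hk]; simp) (by simp), hr]

/-- At high power each `γ_r` is, up to constants, at least `P ‖f_r‖² min(‖g_r‖², 1)` and at most
`P ‖f_r‖² ‖g_r‖²`, because the squared amplification factor stays in a compact subset of
`(0, ∞)`. -/
lemma exists_relaySNR_bounds_single (hNs : 0 < Ns) (hNd : 0 < Nd) (hN₁ : 0 < N₁) (hN₂ : 0 < N₂)
    {ε : ℝ} (hε : 0 < ε) (r : Fin R) (hv : 0 < vf r) :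
    ∃ a b : ℝ, 0 < a ∧ 0 < b ∧ ∀ P t : ℝ, 1 ≤ P → t ∈ Set.Icc ε (1 - ε) →
      ∀ (f : Fin R → Fin Ns → ℂ) (g : Fin R → Fin Nd → ℂ),
        a * P * (channelGain (f r) * min (channelGain (g r)) 1) ≤
            relaySNR N₁ N₂ (t * P) ((1 - t) * P) vf f g r ∧
          relaySNR N₁ N₂ (t * P) ((1 - t) * P) vf f g r ≤
            b * P * (channelGain (f r) * channelGain (g r)) := by
  have hNs' : (0 : ℝ) < Ns := by exact_mod_cast hNs
  have hNd' : (0 : ℝ) < Nd := by exact_mod_cast hNd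
  obtain ⟨v, hvdef⟩ : ∃ v : ℝ, v = vf r := ⟨_, rfl⟩
  have hv' : 0 < v := by rw [hvdef]; exact_mod_cast hv
  -- `l` and `u` bound the squared amplification factor
  obtain ⟨l, hl⟩ : ∃ l, l = ε / (v + N₁) := ⟨_, rfl⟩
  obtain ⟨u, hu⟩ : ∃ u, u = 1 / (v * ε) := ⟨_, rfl⟩
  have hl0 : 0 < l := by rw [hl]; positivity
  have hu0 : 0 < u := by rw [hu]; positivity
  refine ⟨ε * l / (Ns * (u * N₁) + Ns * Nd * N₂), u / (Ns * Nd * N₂), by positivity, by positivity,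
    fun P t hP ht f g => ?_⟩
  have hP0 : 0 < P := by linarith
  have ht0 : 0 < t := hε.trans_le ht.1
  have ht1 : ε ≤ 1 - t := by linarith [ht.2]
  have hlow : l ≤ (1 - t) * P / (v * (t * P) + N₁) := by
    rw [hl, div_le_div_iff₀ (by positivity) (by positivity)]
    have e1 : v * (t * P) + N₁ ≤ P * (v + N₁) := by
      have : v * (t * P) ≤ v * P := by
        refine mul_le_mul_of_nonneg_left ?_ hv'.le
        nlinarith
      nlinarith
    calc ε * (v * (t * P) + N₁) ≤ (1 - t) * (P * (v + N₁)) :=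
          mul_le_mul ht1 e1 (by positivity) (by linarith)
      _ = (1 - t) * P * (v + N₁) := by ring
  have hupp : (1 - t) * P / (v * (t * P) + N₁) ≤ u := by
    rw [hu, div_le_div_iff₀ (by positivity) (by positivity)]
    have e1 : (1 - t) * P * (v * ε) ≤ 1 * P * (v * t) := by
      have := ht.1
      gcongr
      linarith
    linarith
  rw [relaySNR_eq f g r (by rw [← hvdef]; exact hl0.le.trans hlow), ← hvdef]
  set A := (1 - t) * P / (v * (t * P) + N₁)
  have hA : 0 < A := hl0.trans_le hlow
  have hF := channelGain_nonneg (f r)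
  have hG := channelGain_nonneg (g r)
  set F := channelGain (f r)
  set G := channelGain (g r)
  constructor
  · have hm0 : 0 ≤ min G 1 := le_min hG zero_le_one
    -- `min(G, 1)` times the denominator is at most `G` times the constant `Ns (u N₁) + Ns Nd N₂`
    have hden : min G 1 * (Ns * (A * G * N₁) + Ns * Nd * N₂) ≤
        G * (Ns * (u * N₁) + Ns * Nd * N₂) := by
      have e1 : min G 1 * (Ns * (A * G * N₁)) ≤ G * (Ns * (u * N₁)) := by
        calc min G 1 * (Ns * (A * G * N₁)) ≤ 1 * (Ns * (u * G * N₁)) := by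
              gcongr
              exact min_le_right _ _
          _ = G * (Ns * (u * N₁)) := by ring
      have e2 : min G 1 * (Ns * Nd * N₂) ≤ G * (Ns * Nd * N₂) := by
        gcongr
        exact min_le_left _ _
      linarith
    rw [le_div_iff₀ (by positivity), div_mul_eq_mul_div, div_mul_eq_mul_div, div_mul_eq_mul_div,
      div_le_iff₀ (by positivity)]
    calc ε * l * P * (F * min G 1) * (Ns * (A * G * N₁) + Ns * Nd * N₂)
        = ε * P * l * F * (min G 1 * (Ns * (A * G * N₁) + Ns * Nd * N₂)) := by ring
      _ ≤ t * P * A * F * (G * (Ns * (u * N₁) + Ns * Nd * N₂)) := by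
          have := ht.1
          gcongr
      _ = _ := by ring
  · calc t * P * A * F * G / (Ns * (A * G * N₁) + Ns * Nd * N₂)
        ≤ 1 * P * u * F * G / (Ns * Nd * N₂) := by
          gcongr
          · linarith
          · have : 0 ≤ Ns * (A * G * N₁) := by positivity
            linarith
      _ = _ := by ring

/-- The bounds of `exists_relaySNR_bounds_single` with constants common to all relays, in terms of
the transmit SNR `μ`. -/
lemma exists_relaySNR_bounds (hR : 0 < R) (hNs : 0 < Ns) (hNd : 0 < Nd) (hN₁ : 0 < N₁)
    (hN₂ : 0 < N₂) (hv : ∀ r, 0 < vf r) {N₀ : ℝ} (hN₀ : 0 < N₀) {τ : ℝ → ℝ} {ε : ℝ} (hε : 0 < ε)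
    (hτ : ∀ᶠ μ in atTop, τ μ ∈ Set.Icc ε (1 - ε)) :
    ∃ a b : ℝ, 0 < a ∧ 0 < b ∧ ∀ᶠ μ in atTop,
      ∀ (r : Fin R) (f : Fin R → Fin Ns → ℂ) (g : Fin R → Fin Nd → ℂ),
        a * μ * (channelGain (f r) * min (channelGain (g r)) 1) ≤
            relaySNR N₁ N₂ (τ μ * (N₀ * μ)) ((1 - τ μ) * (N₀ * μ)) vf f g r ∧
          relaySNR N₁ N₂ (τ μ * (N₀ * μ)) ((1 - τ μ) * (N₀ * μ)) vf f g r ≤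
            b * μ * (channelGain (f r) * channelGain (g r)) := by
  have : Nonempty (Fin R) := ⟨⟨0, hR⟩⟩
  choose a b ha hb h using fun r => exists_relaySNR_bounds_single (Ns := Ns) (Nd := Nd)
    (vf := vf) hNs hNd hN₁ hN₂ hε r (hv r)
  obtain ⟨i, hi⟩ := Finite.exists_min a
  obtain ⟨j, hj⟩ := Finite.exists_max b
  refine ⟨a i * N₀, b j * N₀, mul_pos (ha i) hN₀, mul_pos (hb j) hN₀, ?_⟩
  filter_upwards [hτ, eventually_ge_atTop (1 / N₀)] with μ hμ hμ1 r f g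
  have hP : 1 ≤ N₀ * μ := by rwa [div_le_iff₀' hN₀] at hμ1
  obtain ⟨h1, h2⟩ := h r (N₀ * μ) (τ μ) hP hμ f g
  have hF := channelGain_nonneg (f r)
  have hG := channelGain_nonneg (g r)
  have hm : 0 ≤ min (channelGain (g r)) 1 := le_min hG zero_le_one
  constructor
  · refine le_trans ?_ h1
    rw [mul_assoc (a i)]
    gcongr
    exact hi r
  · refine h2.trans ?_
    rw [mul_assoc (b j)]
    gcongr
    exact hj r

lemma relaySNR_le_opportunisticSNR (f : Fin R → Fin Ns → ℂ) (g : Fin R → Fin Nd → ℂ) (r : Fin R) :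
    relaySNR N₁ N₂ P₁ P₂ vf f g r ≤ opportunisticSNR N₁ N₂ P₁ P₂ vf f g :=
  le_ciSup (f := fun r => relaySNR N₁ N₂ P₁ P₂ vf f g r) (Set.finite_range _).bddAbove r

lemma aemeasurable_opportunisticSNR {Ω : Type*} [MeasurableSpace Ω] {prob : Measure Ω}
    {f : Fin R → Fin Ns → Ω → ℂ} {g : Fin R → Fin Nd → Ω → ℂ}
    (hf : ∀ r n, AEMeasurable (f r n) prob) (hg : ∀ r j, AEMeasurable (g r j) prob) :
    AEMeasurable (fun ω => opportunisticSNR N₁ N₂ P₁ P₂ vf (fun r n => f r n ω)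
      (fun r j => g r j ω)) prob := by
  unfold opportunisticSNR relaySNR receivedSNR channelGain
  exact AEMeasurable.iSup fun r => by fun_prop

end SNR

/-! ### Diversity order from power-law bounds -/

/-- A function squeezed between `μ ^ (-d)` and every `μ ^ (-d')` with `d' < d`, up to constants, has
diversity order `d`; logarithmic factors in the upper bound are allowed in this way. -/
lemma hasDiversityOrder_of_bounds {Pe : ℝ → ℝ} {d : ℝ} (hd : 0 < d)
    (hlow : ∃ c : ℝ, 0 < c ∧ ∀ᶠ μ in atTop, c * μ ^ (-d) ≤ Pe μ)
    (hupp : ∀ d', 0 < d' → d' < d → ∃ C : ℝ, 0 < C ∧ ∀ᶠ μ in atTop, Pe μ ≤ C * μ ^ (-d')) :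
    HasDiversityOrder Pe d := by
  obtain ⟨c, hc, hlow⟩ := hlow
  have hlim : ∀ K e : ℝ, Tendsto (fun μ : ℝ => e - Real.log K / Real.log μ) atTop (𝓝 e) := by
    intro K e
    simpa using tendsto_const_nhds.sub (Real.tendsto_log_atTop.const_div_atTop (Real.log K))
  have hlog : ∀ K e μ : ℝ, 0 < K → 1 < μ →
      -(Real.log (K * μ ^ (-e)) / Real.log μ) = e - Real.log K / Real.log μ := by
    intro K e μ hK hμ
    have hL : 0 < Real.log μ := Real.log_pos hμ
    rw [Real.log_mul hK.ne' (by positivity), Real.log_rpow (by linarith)]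
    field_simp
    ring
  refine tendsto_order.2 ⟨fun x hx => ?_, fun x hx => ?_⟩
  · obtain ⟨d', h1, h2⟩ := exists_between (max_lt hx hd)
    obtain ⟨C, hC, hupp⟩ := hupp d' ((le_max_right _ _).trans_lt h1) h2
    filter_upwards [hlow, hupp, (hlim C d').eventually_const_lt ((le_max_left _ _).trans_lt h1),
      eventually_gt_atTop 1] with μ hl hu hx hμ
    refine hx.trans_le ?_
    have hPe : 0 < Pe μ := lt_of_lt_of_le (by positivity) hl
    have hL : 0 < Real.log μ := Real.log_pos hμ
    rw [← hlog C d' μ hC hμ]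
    gcongr
  · filter_upwards [hlow, (hlim c d).eventually_lt_const hx, eventually_gt_atTop 1]
      with μ hl hx hμ
    refine lt_of_le_of_lt ?_ hx
    have hL : 0 < Real.log μ := Real.log_pos hμ
    have h0 : 0 < c * μ ^ (-d) := by positivity
    rw [← hlog c d μ hc hμ]
    gcongr

/-! ### The average symbol error rate -/

section SER

variable {Ω : Type*} [MeasurableSpace Ω] {prob : Measure Ω} {R Ns Nd : ℕ} {vf vg : Fin R → ℝ≥0}
  {f : Fin R → Fin Ns → Ω → ℂ} {g : Fin R → Fin Nd → Ω → ℂ}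

/-- Independence turns the expectation of a product over all channel coefficients into the product
of the expectations under the Gaussian laws. -/
lemma IsRayleighFading.lintegral_prod (h : IsRayleighFading prob vf vg f g)
    {φ ψ : ℂ → ENNReal} (hφ : Measurable φ) (hψ : Measurable ψ) :
    ∫⁻ ω, ∏ r, ((∏ n, φ (f r n ω)) * ∏ j, ψ (g r j ω)) ∂prob =
      ∏ r, ((∫⁻ z, φ z ∂complexGaussian (vf r)) ^ Ns *
        (∫⁻ z, ψ z ∂complexGaussian (vg r)) ^ Nd) := by
  have key := lintegral_prod_comp_of_iIndepFun h.indep (fun i => by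
      rcases i with i | i
      · exact (h.law_f i.1 i.2).aemeasurable
      · exact (h.law_g i.1 i.2).aemeasurable)
    (φ := Sum.elim (fun _ => φ) (fun _ => ψ)) (fun i => by
      rcases i with i | i
      · exact hφ
      · exact hψ)
  simp only [Fintype.prod_sum_type, Sum.elim_inl, Sum.elim_inr, Fintype.prod_prod_type] at key
  simp only [Finset.prod_mul_distrib] at key ⊢
  rw [key]
  congr 1
  · refine Finset.prod_congr rfl fun r _ => ?_
    rw [Finset.prod_congr rfl fun n _ => (h.law_f r n).lintegral_comp hφ.aemeasurable]
    simp
  · refine Finset.prod_congr rfl fun r _ => ?_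
    rw [Finset.prod_congr rfl fun j _ => (h.law_g r j).lintegral_comp hψ.aemeasurable]
    simp

/-- All source-relay coefficients have power at most `tf` and all relay-destination coefficients
power at most `tg` with probability at least of order `tf ^ (R Ns) * tg ^ (R Nd)`. -/
lemma IsRayleighFading.exists_le_measure_small (h : IsRayleighFading prob vf vg f g)
    (hvf : ∀ r, 0 < vf r) (hvg : ∀ r, 0 < vg r) :
    ∃ c : ℝ, 0 < c ∧ ∀ tf tg : ℝ, 0 ≤ tf → tf ≤ 1 → 0 ≤ tg → tg ≤ 1 →
      ENNReal.ofReal (c * (tf ^ Ns * tg ^ Nd) ^ R) ≤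
        prob {ω | ∀ r, (∀ n, ‖f r n ω‖ ^ 2 ≤ tf) ∧ ∀ j, ‖g r j ω‖ ^ 2 ≤ tg} := by
  choose cf hcf hf using fun r => exists_le_complexGaussian_sq_norm_le (hvf r)
  choose cg hcg hg using fun r => exists_le_complexGaussian_sq_norm_le (hvg r)
  refine ⟨∏ r, (cf r ^ Ns * cg r ^ Nd), Finset.prod_pos fun r _ => by
    have := hcf r; have := hcg r; positivity, fun tf tg hf0 hf1 hg0 hg1 => ?_⟩
  have hmeas : ∀ t : ℝ, MeasurableSet {z : ℂ | ‖z‖ ^ 2 ≤ t} := fun t =>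
    measurableSet_le (by fun_prop) measurable_const
  have hind := h.indep.measure_inter_preimage_eq_mul Finset.univ
    (sets := Sum.elim (fun _ => {z : ℂ | ‖z‖ ^ 2 ≤ tf}) (fun _ => {z : ℂ | ‖z‖ ^ 2 ≤ tg}))
    (fun i _ => by
      rcases i with i | i
      · exact hmeas tf
      · exact hmeas tg)
  have hlf : ∀ r n, prob (f r n ⁻¹' {z : ℂ | ‖z‖ ^ 2 ≤ tf}) =
      complexGaussian (vf r) {z : ℂ | ‖z‖ ^ 2 ≤ tf} :=
    fun r n => (h.law_f r n).measure_eq (hmeas tf)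
  have hlg : ∀ r j, prob (g r j ⁻¹' {z : ℂ | ‖z‖ ^ 2 ≤ tg}) =
      complexGaussian (vg r) {z : ℂ | ‖z‖ ^ 2 ≤ tg} :=
    fun r j => (h.law_g r j).measure_eq (hmeas tg)
  simp only [Fintype.prod_sum_type, Sum.elim_inl, Sum.elim_inr, Fintype.prod_prod_type, hlf, hlg,
    Finset.prod_const, Finset.card_univ, Fintype.card_fin] at hind
  have hset : (⋂ i ∈ Finset.univ, (Sum.elim (fun i : Fin R × Fin Ns => f i.1 i.2)
      (fun i : Fin R × Fin Nd => g i.1 i.2) i) ⁻¹' (Sum.elim (fun _ => {z : ℂ | ‖z‖ ^ 2 ≤ tf})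
      (fun _ => {z : ℂ | ‖z‖ ^ 2 ≤ tg}) i)) =
      {ω | ∀ r, (∀ n, ‖f r n ω‖ ^ 2 ≤ tf) ∧ ∀ j, ‖g r j ω‖ ^ 2 ≤ tg} := by
    ext ω
    simp [forall_and]
  rw [hset] at hind
  rw [hind, ← Finset.prod_mul_distrib]
  calc ENNReal.ofReal ((∏ r, (cf r ^ Ns * cg r ^ Nd)) * (tf ^ Ns * tg ^ Nd) ^ R)
      = ∏ r, (ENNReal.ofReal (cf r * tf) ^ Ns * ENNReal.ofReal (cg r * tg) ^ Nd) := by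
        have e : (∏ r, (cf r ^ Ns * cg r ^ Nd)) * (tf ^ Ns * tg ^ Nd) ^ R =
            ∏ r, ((cf r * tf) ^ Ns * (cg r * tg) ^ Nd) := by
          rw [show (tf ^ Ns * tg ^ Nd) ^ R = ∏ _r : Fin R, (tf ^ Ns * tg ^ Nd) by simp,
            ← Finset.prod_mul_distrib]
          refine Finset.prod_congr rfl fun r _ => ?_
          ring
        rw [e, ENNReal.ofReal_prod_of_nonneg fun r _ => by
          have := hcf r; have := hcg r; positivity]
        refine Finset.prod_congr rfl fun r _ => ?_
        have h1 := hcf r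
        have h2 := hcg r
        rw [ENNReal.ofReal_mul (by positivity), ENNReal.ofReal_pow (by positivity),
          ENNReal.ofReal_pow (by positivity)]
    _ ≤ _ := by
        refine Finset.prod_le_prod' fun r _ => ?_
        gcongr
        · exact hf r tf hf0 hf1
        · exact hg r tg hg0 hg1

lemma opportunisticSER_nonneg {c κ N₁ N₂ P₁ P₂ : ℝ} (hc : 0 ≤ c) :
    0 ≤ opportunisticSER prob c κ N₁ N₂ P₁ P₂ vf f g :=
  integral_nonneg fun _ => mul_nonneg hc (gaussianQ_pos _).le

lemma IsRayleighFading.aemeasurable_conditionalSER (h : IsRayleighFading prob vf vg f g)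
    (c κ N₁ N₂ P₁ P₂ : ℝ) :
    AEMeasurable (fun ω => c * gaussianQ (√(κ * opportunisticSNR N₁ N₂ P₁ P₂ vf
      (fun r n => f r n ω) (fun r j => g r j ω)))) prob := by
  have h1 := aemeasurable_opportunisticSNR (prob := prob) (N₁ := N₁) (N₂ := N₂) (P₁ := P₁)
    (P₂ := P₂) (vf := vf) (fun r n => (h.law_f r n).aemeasurable)
    (fun r j => (h.law_g r j).aemeasurable)
  exact ((gaussianQ_antitone.measurable).comp_aemeasurable (h1.const_mul κ).sqrt).const_mul c

lemma IsRayleighFading.ofReal_opportunisticSER [IsProbabilityMeasure prob]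
    (h : IsRayleighFading prob vf vg f g) {c : ℝ} (hc : 0 ≤ c) (κ N₁ N₂ P₁ P₂ : ℝ) :
    ENNReal.ofReal (opportunisticSER prob c κ N₁ N₂ P₁ P₂ vf f g) =
      ∫⁻ ω, ENNReal.ofReal (c * gaussianQ (√(κ * opportunisticSNR N₁ N₂ P₁ P₂ vf
        (fun r n => f r n ω) (fun r j => g r j ω)))) ∂prob := by
  refine ofReal_integral_eq_lintegral_ofReal ?_
    (ae_of_all _ fun ω => mul_nonneg hc (gaussianQ_pos _).le)
  refine Integrable.of_bound (h.aemeasurable_conditionalSER c κ N₁ N₂ P₁ P₂).aestronglyMeasurable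
    (c * gaussianQ 0) (ae_of_all _ fun ω => ?_)
  rw [Real.norm_of_nonneg (mul_nonneg hc (gaussianQ_pos _).le)]
  exact mul_le_mul_of_nonneg_left (gaussianQ_antitone (Real.sqrt_nonneg _)) hc

/-- The outage event that all coefficients of the weaker hop have power `O(1/μ)`, at every relay,
already contributes `μ ^ (-R min(Ns, Nd))` to the error rate. -/
lemma IsRayleighFading.exists_le_opportunisticSER [IsProbabilityMeasure prob]
    (h : IsRayleighFading prob vf vg f g) (hR : 0 < R) (hNs : 0 < Ns) (hNd : 0 < Nd)
    (hvf : ∀ r, 0 < vf r) (hvg : ∀ r, 0 < vg r) {c κ N₁ N₂ b : ℝ} (hc : 0 < c) (hκ : 0 < κ)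
    (hb : 0 < b) {P₁ P₂ : ℝ → ℝ}
    (hsnr : ∀ᶠ μ in atTop, ∀ (r : Fin R) (f : Fin R → Fin Ns → ℂ) (g : Fin R → Fin Nd → ℂ),
      relaySNR N₁ N₂ (P₁ μ) (P₂ μ) vf f g r ≤ b * μ * (channelGain (f r) * channelGain (g r))) :
    ∃ C : ℝ, 0 < C ∧ ∀ᶠ μ in atTop, C * μ ^ (-((R * min Ns Nd : ℕ) : ℝ)) ≤
      opportunisticSER prob c κ N₁ N₂ (P₁ μ) (P₂ μ) vf f g := by
  have : Nonempty (Fin R) := ⟨⟨0, hR⟩⟩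
  obtain ⟨C₀, hC₀, hC⟩ := h.exists_le_measure_small hvf hvg
  have hQ := gaussianQ_pos 1
  have hNs' : (0 : ℝ) < Ns := by exact_mod_cast hNs
  have hNd' : (0 : ℝ) < Nd := by exact_mod_cast hNd
  -- on the event below, `κ γ_max ≤ κ b μ (Ns tf) (Nd tg) = 1`, where `tf * tg = 1 / (D μ)`
  obtain ⟨D, hD⟩ : ∃ D, D = κ * b * Ns * Nd := ⟨_, rfl⟩
  have hD0 : 0 < D := by rw [hD]; positivity
  refine ⟨c * gaussianQ 1 * (C₀ * (1 / D) ^ (R * min Ns Nd)), by positivity, ?_⟩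
  filter_upwards [hsnr, eventually_ge_atTop (1 / D), eventually_gt_atTop 0] with μ hμ hμ1 hμ0
  obtain ⟨t, ht⟩ : ∃ t, t = 1 / (D * μ) := ⟨_, rfl⟩
  have ht0 : 0 < t := by rw [ht]; positivity
  have ht1 : t ≤ 1 := by
    rw [ht, div_le_one (by positivity)]
    rwa [div_le_iff₀' hD0] at hμ1
  obtain ⟨tf, tg, hf0, hf1, hg0, hg1, hfg, hpow⟩ : ∃ tf tg : ℝ, 0 ≤ tf ∧ tf ≤ 1 ∧ 0 ≤ tg ∧
      tg ≤ 1 ∧ tf * tg = t ∧ tf ^ Ns * tg ^ Nd = t ^ min Ns Nd := by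
    rcases le_total Ns Nd with hle | hle
    · exact ⟨t, 1, ht0.le, ht1, zero_le_one, le_rfl, by simp, by simp [hle]⟩
    · exact ⟨1, t, zero_le_one, le_rfl, ht0.le, ht1, by simp, by simp [hle]⟩
  have hmeas := hC tf tg hf0 hf1 hg0 hg1
  rw [← ENNReal.ofReal_le_ofReal_iff (opportunisticSER_nonneg hc.le),
    h.ofReal_opportunisticSER hc.le]
  refine le_trans ?_ (mul_meas_ge_le_lintegral₀
    (h.aemeasurable_conditionalSER c κ N₁ N₂ (P₁ μ) (P₂ μ)).ennreal_ofReal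
    (ENNReal.ofReal (c * gaussianQ 1)))
  calc ENNReal.ofReal (c * gaussianQ 1 * (C₀ * (1 / D) ^ (R * min Ns Nd)) *
        μ ^ (-((R * min Ns Nd : ℕ) : ℝ)))
      = ENNReal.ofReal (c * gaussianQ 1) * ENNReal.ofReal (C₀ * (tf ^ Ns * tg ^ Nd) ^ R) := by
        rw [← ENNReal.ofReal_mul (by positivity), hpow, ← pow_mul, ht, Real.rpow_neg hμ0.le,
          Real.rpow_natCast, mul_comm (min Ns Nd) R]
        congr 1
        rw [one_div, one_div, mul_inv, mul_pow, inv_pow μ]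
        ring
    _ ≤ _ := by
        gcongr
        refine hmeas.trans (measure_mono fun ω hω => ?_)
        refine ENNReal.ofReal_le_ofReal (mul_le_mul_of_nonneg_left (gaussianQ_antitone ?_) hc.le)
        rw [Real.sqrt_le_one]
        have hmax : opportunisticSNR N₁ N₂ (P₁ μ) (P₂ μ) vf (fun r n => f r n ω)
            (fun r j => g r j ω) ≤ b * μ * (Ns * tf * (Nd * tg)) := by
          refine ciSup_le fun r => (hμ r _ _).trans ?_
          have h1 := channelGain_le _ (hω r).1
          have h2 := channelGain_le _ (hω r).2
          have h3 := channelGain_nonneg fun j => g r j ω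
          gcongr
        calc _ ≤ κ * (b * μ * (Ns * tf * (Nd * tg))) := mul_le_mul_of_nonneg_left hmax hκ.le
          _ = D * μ * (tf * tg) := by rw [hD]; ring
          _ = 1 := by rw [hfg, ht]; field_simp

/-- Each factor of the power `γ_max ^ (-R s)` is at most the corresponding `γ_r ^ (-s)`, which is
bounded by negative powers of the individual channel coefficients. -/
lemma ofReal_opportunisticSNR_rpow_neg_le (hNs : 0 < Ns) (hNd : 0 < Nd)
    {N₁ N₂ P₁ P₂ a μ s : ℝ} (ha : 0 < a) (hμ : 0 < μ) (hs : 0 < s)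
    {f : Fin R → Fin Ns → ℂ} {g : Fin R → Fin Nd → ℂ}
    (hsnr : ∀ r, a * μ * (channelGain (f r) * min (channelGain (g r)) 1) ≤
      relaySNR N₁ N₂ P₁ P₂ vf f g r) :
    ENNReal.ofReal (opportunisticSNR N₁ N₂ P₁ P₂ vf f g) ^ (-(R * s)) ≤
      ENNReal.ofReal ((a * μ) ^ (-(R * s))) *
        ∏ r, ((∏ n, truncPower (f r n) ^ (-(s / Ns))) * ∏ j, truncPower (g r j) ^ (-(s / Nd))) := by
  have hexp : ∀ n : ℕ, ∀ z, truncPower z ^ (-(s / n)) = (truncPower z ^ (1 / n : ℝ)) ^ (-s) := by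
    intro n z
    rw [← ENNReal.rpow_mul]
    congr 1
    ring
  have htop : ∀ n : ℕ, ∀ z, truncPower z ^ (1 / n : ℝ) ≠ ⊤ := fun n z =>
    ENNReal.rpow_ne_top_of_nonneg (by positivity) (truncPower_ne_top z)
  have hr : ∀ r, ENNReal.ofReal (opportunisticSNR N₁ N₂ P₁ P₂ vf f g) ^ (-s) ≤
      ENNReal.ofReal (a * μ) ^ (-s) *
        ((∏ n, truncPower (f r n) ^ (-(s / Ns))) * ∏ j, truncPower (g r j) ^ (-(s / Nd))) := by
    intro r
    simp only [hexp]
    rw [ENNReal.prod_rpow_of_ne_top fun n _ => htop Ns _,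
      ENNReal.prod_rpow_of_ne_top fun n _ => htop Nd _,
      ← ENNReal.mul_rpow_of_ne_top (ENNReal.prod_ne_top fun n _ => htop Ns _)
        (ENNReal.prod_ne_top fun n _ => htop Nd _),
      ← ENNReal.mul_rpow_of_ne_top ENNReal.ofReal_ne_top (ENNReal.mul_ne_top
        (ENNReal.prod_ne_top fun n _ => htop Ns _) (ENNReal.prod_ne_top fun n _ => htop Nd _)),
      ENNReal.rpow_neg, ENNReal.rpow_neg]
    refine ENNReal.inv_le_inv.2 (ENNReal.rpow_le_rpow ?_ hs.le)
    have hF := channelGain_nonneg (f r)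
    calc _ ≤ ENNReal.ofReal (a * μ) * (ENNReal.ofReal (channelGain (f r)) *
          ENNReal.ofReal (min (channelGain (g r)) 1)) := by
          gcongr
          · exact (prod_truncPower_rpow_le hNs _).trans
              (ENNReal.ofReal_le_ofReal (min_le_left _ _))
          · exact prod_truncPower_rpow_le hNd _
      _ = ENNReal.ofReal (a * μ * (channelGain (f r) * min (channelGain (g r)) 1)) := by
          rw [← ENNReal.ofReal_mul hF, ← ENNReal.ofReal_mul (by positivity)]
      _ ≤ _ := ENNReal.ofReal_le_ofReal
          ((hsnr r).trans (relaySNR_le_opportunisticSNR f g r))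
  have hpow : ∀ x : ENNReal, x ^ (-(R * s)) = ∏ _r : Fin R, x ^ (-s) := by
    intro x
    rw [Finset.prod_const, Finset.card_univ, Fintype.card_fin, ← ENNReal.rpow_natCast,
      ← ENNReal.rpow_mul]
    congr 1
    ring
  rw [← ENNReal.ofReal_rpow_of_pos (by positivity), hpow, hpow, ← Finset.prod_mul_distrib]
  exact Finset.prod_le_prod' fun r _ => hr r

/-- The error rate decays at least like `μ ^ (-R s)` for every `s < min(Ns, Nd)`; the condition on
`s` is what makes the negative moments of the channel coefficients finite. -/
lemma IsRayleighFading.exists_opportunisticSER_le [IsProbabilityMeasure prob]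
    (h : IsRayleighFading prob vf vg f g) (hR : 0 < R) (hNs : 0 < Ns) (hNd : 0 < Nd)
    (hvf : ∀ r, 0 < vf r) (hvg : ∀ r, 0 < vg r) {c κ N₁ N₂ a : ℝ} (hc : 0 < c) (hκ : 0 < κ)
    (ha : 0 < a) {P₁ P₂ : ℝ → ℝ}
    (hsnr : ∀ᶠ μ in atTop, ∀ (r : Fin R) (f : Fin R → Fin Ns → ℂ) (g : Fin R → Fin Nd → ℂ),
      a * μ * (channelGain (f r) * min (channelGain (g r)) 1) ≤
        relaySNR N₁ N₂ (P₁ μ) (P₂ μ) vf f g r)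
    {s : ℝ} (hs : 0 < s) (hsNs : s < Ns) (hsNd : s < Nd) :
    ∃ C : ℝ, 0 < C ∧ ∀ᶠ μ in atTop,
      opportunisticSER prob c κ N₁ N₂ (P₁ μ) (P₂ μ) vf f g ≤ C * μ ^ (-(R * s)) := by
  obtain ⟨B, hB, hQ⟩ := exists_gaussianQ_le
  have hR' : (0 : ℝ) < R := by exact_mod_cast hR
  have hNs' : (0 : ℝ) < Ns := by exact_mod_cast hNs
  have hNd' : (0 : ℝ) < Nd := by exact_mod_cast hNd
  have hp : 0 < R * s := by positivity
  -- the product of all negative moments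
  obtain ⟨M, hM⟩ : ∃ M, M = ∏ r, ((∫⁻ z, truncPower z ^ (-(s / Ns)) ∂complexGaussian (vf r)) ^ Ns *
      (∫⁻ z, truncPower z ^ (-(s / Nd)) ∂complexGaussian (vg r)) ^ Nd) := ⟨_, rfl⟩
  have hMtop : M ≠ ⊤ := by
    rw [hM]
    refine ENNReal.prod_ne_top fun r _ => ENNReal.mul_ne_top ?_ ?_
    · exact ENNReal.pow_ne_top (lintegral_complexGaussian_min_rpow_neg_lt_top (hvf r)
        (by positivity) ((div_lt_one hNs').2 hsNs)).ne
    · exact ENNReal.pow_ne_top (lintegral_complexGaussian_min_rpow_neg_lt_top (hvg r)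
        (by positivity) ((div_lt_one hNd').2 hsNd)).ne
  obtain ⟨K, hK⟩ : ∃ K, K = c * B * (R * s) ^ (R * s) * (κ / 4) ^ (-(R * s)) := ⟨_, rfl⟩
  have hK0 : 0 < K := by rw [hK]; positivity
  refine ⟨K * a ^ (-(R * s)) * (M.toReal + 1), by positivity, ?_⟩
  filter_upwards [hsnr, eventually_gt_atTop 0] with μ hμ hμ0
  rw [← ENNReal.ofReal_le_ofReal_iff (by positivity), h.ofReal_opportunisticSER hc.le]
  have hpt : ∀ ω, ENNReal.ofReal (c * gaussianQ (√(κ * opportunisticSNR N₁ N₂ (P₁ μ) (P₂ μ) vf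
        (fun r n => f r n ω) (fun r j => g r j ω)))) ≤
      ENNReal.ofReal (K * (a * μ) ^ (-(R * s))) *
        ∏ r, ((∏ n, truncPower (f r n ω) ^ (-(s / Ns))) *
          ∏ j, truncPower (g r j ω) ^ (-(s / Nd))) := by
    intro ω
    have hub := ofReal_opportunisticSNR_rpow_neg_le hNs hNd ha hμ0 hs
      fun r => hμ r (fun r n => f r n ω) (fun r j => g r j ω)
    have hγ : 0 ≤ opportunisticSNR N₁ N₂ (P₁ μ) (P₂ μ) vf (fun r n => f r n ω)
        (fun r j => g r j ω) := by
      refine le_trans ?_ (relaySNR_le_opportunisticSNR _ _ ⟨0, hR⟩)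
      refine le_trans ?_ (hμ _ _ _)
      have h1 := channelGain_nonneg fun n => f ⟨0, hR⟩ n ω
      have h2 := channelGain_nonneg fun j => g ⟨0, hR⟩ j ω
      positivity
    set γ := opportunisticSNR N₁ N₂ (P₁ μ) (P₂ μ) vf (fun r n => f r n ω) (fun r j => g r j ω)
    calc ENNReal.ofReal (c * gaussianQ (√(κ * γ)))
        ≤ ENNReal.ofReal (c * B * Real.exp (-(κ / 4 * γ))) := by
          refine ENNReal.ofReal_le_ofReal ?_
          have := hQ _ (Real.sqrt_nonneg (κ * γ))
          rw [Real.sq_sqrt (by positivity)] at this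
          rw [mul_assoc, show κ / 4 * γ = κ * γ / 4 by ring]
          gcongr
      _ ≤ ENNReal.ofReal (c * B) * (ENNReal.ofReal ((R * s) ^ (R * s)) *
            (ENNReal.ofReal (κ / 4) * ENNReal.ofReal γ) ^ (-(R * s))) := by
          rw [ENNReal.ofReal_mul (p := c * B) (by positivity),
            ← ENNReal.ofReal_mul (p := κ / 4) (by positivity)]
          gcongr
          exact ofReal_exp_neg_le_rpow (by positivity) hp
      _ = ENNReal.ofReal K * ENNReal.ofReal γ ^ (-(R * s)) := by
          rw [ENNReal.mul_rpow_of_ne_top ENNReal.ofReal_ne_top ENNReal.ofReal_ne_top,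
            ENNReal.ofReal_rpow_of_pos (by positivity), hK,
            ENNReal.ofReal_mul (p := c * B * (R * s) ^ (R * s)) (by positivity),
            ENNReal.ofReal_mul (p := c * B) (by positivity)]
          simp only [mul_assoc]
      _ ≤ ENNReal.ofReal K * (ENNReal.ofReal ((a * μ) ^ (-(R * s))) * _) := by gcongr
      _ = _ := by rw [← mul_assoc, ← ENNReal.ofReal_mul hK0.le]
  calc _ ≤ _ := lintegral_mono hpt
    _ = ENNReal.ofReal (K * (a * μ) ^ (-(R * s))) * M := by
        rw [lintegral_const_mul' _ _ ENNReal.ofReal_ne_top,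
          h.lintegral_prod (φ := fun z => truncPower z ^ (-(s / Ns)))
            (ψ := fun z => truncPower z ^ (-(s / Nd))) (by fun_prop) (by fun_prop), hM]
    _ ≤ ENNReal.ofReal (K * (a * μ) ^ (-(R * s))) * ENNReal.ofReal (M.toReal + 1) := by
        gcongr
        exact ENNReal.le_ofReal_iff_toReal_le hMtop (by positivity) |>.2 (by linarith)
    _ = _ := by
        rw [← ENNReal.ofReal_mul (by positivity), Real.mul_rpow ha.le hμ0.le]
        congr 1
        ring

end SER

theorem corollary1 {Ω : Type*} [MeasurableSpace Ω] (prob : Measure Ω) [IsProbabilityMeasure prob]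
    {R Ns Nd : ℕ} (hR : 0 < R) (hNs : 0 < Ns) (hNd : 0 < Nd)
    -- independent Rayleigh fading with positive variances
    (vf vg : Fin R → ℝ≥0) (hvf : ∀ r, 0 < vf r) (hvg : ∀ r, 0 < vg r)
    (f : Fin R → Fin Ns → Ω → ℂ) (g : Fin R → Fin Nd → Ω → ℂ)
    (hfading : IsRayleighFading prob vf vg f g)
    -- modulation parameters and noise variances at the relays and at the destination
    (c κ N₁ N₂ : ℝ) (hc : 0 < c) (hκ : 0 < κ) (hN₁ : 0 < N₁) (hN₂ : 0 < N₂)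
    -- the transmit SNR is `μ = P / N₀`, with `P` the total power and `N₀` a reference noise level
    (N₀ : ℝ) (hN₀ : 0 < N₀)
    -- fraction of the total power that is used in the first phase (constant, or varying with `μ`)
    (τ : ℝ → ℝ) (ε : ℝ) (hε : 0 < ε) (hτ : ∀ᶠ μ in atTop, τ μ ∈ Set.Icc ε (1 - ε)) :
    HasDiversityOrder
      (fun μ => opportunisticSER prob c κ N₁ N₂ (τ μ * (N₀ * μ)) ((1 - τ μ) * (N₀ * μ)) vf f g)
      (R * min Ns Nd : ℕ) := by
  obtain ⟨a, b, ha, hb, hsnr⟩ :=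
    exists_relaySNR_bounds hR hNs hNd hN₁ hN₂ hvf hN₀ hε hτ
  have hR' : (0 : ℝ) < R := by exact_mod_cast hR
  refine hasDiversityOrder_of_bounds (by positivity)
    (hfading.exists_le_opportunisticSER hR hNs hNd hvf hvg hc hκ hb
      (hsnr.mono fun μ h r f g => (h r f g).2)) fun d' hd0 hd => ?_
  have hs : d' / R < min Ns Nd := by
    rw [div_lt_iff₀' hR']
    exact_mod_cast hd
  have key := hfading.exists_opportunisticSER_le hR hNs hNd hvf hvg hc hκ ha
    (hsnr.mono fun μ h r f g => (h r f g).1) (s := d' / R) (by positivity)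
    (hs.trans_le (by exact_mod_cast min_le_left _ _))
    (hs.trans_le (by exact_mod_cast min_le_right _ _))
  rwa [mul_div_cancel₀ _ hR'.ne'] at key
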